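/- Let $n\ge 1$. There is a constant $C>0$ depending only on $n$ such that the following holds. Let $0\le\delta<1$, $1\le q\le \frac{n}{n-\delta}$ and $\alpha=n-q(n-\delta)$. Let $\mu$ be a Radon measure on $\mathbb{R}^n$ and $f:\mathbb{R}^n\to\mathbb{R}$, and assume that either (a) $f\in L^1_{\mathrm{loc}}(\mathbb{R}^n)$ and $\mu$ is absolutely continuous with respect to Lebesgue measure, or (b) $f$ is continuous (and $\mu$ is an arbitrary Radon measure). Then for every cube $Q=[a_1,a_1+l]\times\dots\times[a_n,a_n+l]\subset\mathbb{R}^n$, $l>0$, $$ \Bigl(\int_Q |f-f_Q|^q\,d\mu\Bigr)^{1/q} \le C(1-\delta)\int_Q\int_Q\frac{|f(x)-f(y)|}{|x-y|^{n+\delta}}\,dy\,\bigl(M^d_{\alpha,Q}\mu(x)\bigr)^{1/q}\,dx , $$ where both sides may be infinite. Here $f_Q=\frac1{|Q|}\int_Q f\,dx$, $|\cdot|$ denotes the Euclidean norm of a point and the Lebesgue measure of a set, and $$ M^d_{\alpha,Q}\mu(x)=\sup\Bigl\{\, l(P)^{\alpha}\,\frac{\mu(P)}{|P|} \;:\; P\in\mathcal{D}(Q),\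 x\in P\Bigr\}, $$ where $l(P)$ is the side length of $P$ and $\mathcal{D}(Q)=\bigcup_{k\ge0}\mathcal{D}_k(Q)$ is the set of dyadic subcubes of $Q$: $\mathcal{D}_k(Q)$ consists of the $2^{kn}$ closed cubes of side length $2^{-k}l$ obtained by dividing each side of $Q$ into $2^k$ equal intervals. -/

import Mathlib

open MeasureTheory
open scoped ENNReal

/-- A cube in `ℝⁿ`: closed, axes-parallel, nondegenerate, given by its lower corner
`(a₁, …, aₙ)` and its side length `l > 0`. -/
structure Cube (n : ℕ) where
  /-- the lower corner `(a₁, …, aₙ)` -/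
  corner : EuclideanSpace ℝ (Fin n)
  /-- the side length `l` -/
  side : ℝ
  side_pos : 0 < side

namespace Cube

variable {n : ℕ}

/-- The point set `[a₁, a₁ + l] × ⋯ × [aₙ, aₙ + l]` of a cube. -/
def toSet (Q : Cube n) : Set (EuclideanSpace ℝ (Fin n)) :=
  {x | ∀ i, Q.corner i ≤ x i ∧ x i ≤ Q.corner i + Q.side}

/-- The dyadic subcube of `Q` of generation `k` at grid position `m ∈ {0, …, 2ᵏ - 1}ⁿ`; it has
side length `2⁻ᵏ l` and lower corner `a + 2⁻ᵏ l m`. -/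
noncomputable def dyadicSubcube (Q : Cube n) (k : ℕ) (m : Fin n → Fin (2 ^ k)) : Cube n where
  corner := WithLp.toLp 2 fun i => Q.corner i + ((m i : ℕ) : ℝ) * (Q.side / 2 ^ k)
  side := Q.side / 2 ^ k
  side_pos := div_pos Q.side_pos (by positivity)

/-- The set `𝓓_k(Q)` of dyadic subcubes of generation `k`. -/
def dyadicGeneration (Q : Cube n) (k : ℕ) : Set (Cube n) :=
  Set.range (Q.dyadicSubcube k)

/-- The set `𝓓(Q)` of all dyadic subcubes of `Q`. -/
def dyadicSubcubes (Q : Cube n) : Set (Cube n) :=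
  ⋃ k : ℕ, Q.dyadicGeneration k

end Cube

/-- The local dyadic fractional maximal function
`M^d_{α,Q} μ (x) = sup { l(P)^α μ(P) / |P| : P ∈ 𝓓(Q), x ∈ P }`, with values in `[0, ∞]`. -/
noncomputable def dyadicFracMaximal {n : ℕ} (α : ℝ) (Q : Cube n)
    (μ : Measure (EuclideanSpace ℝ (Fin n))) (x : EuclideanSpace ℝ (Fin n)) : ℝ≥0∞ :=
  ⨆ P ∈ Q.dyadicSubcubes, ⨆ (_ : x ∈ P.toSet),
    ENNReal.ofReal (P.side ^ α) * (μ P.toSet / volume P.toSet)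

/-! The inequality is reduced to characteristic functions. Since `|f x - f y|` is the integral over
`t` of `|1_{f>t}(x) - 1_{f>t}(y)|`, the left side is bounded through Minkowski's integral inequality
by an integral over `t` of left sides for the sets `{f > t}`. The right side is linear in the same
decomposition, so a bound for sets `E` suffices (`lintegral_avgCharEdist_le`).

For a set, pass to the complement if necessary so that `E` fills at most half of `Q`. Almost every
point of `E` lies in a small dyadic cube more than half filled by `E`; climbing through ancestors
reaches a balanced cube `P`, where `E` and its complement both occupy a fixed fraction
(`Cube.exists_isBalanced`). There the unweighted fractional Poincaré inequality acts as an
isoperimetric inequality. The choice of `α` gives `μ(P)^{1/q} = l(P)^{n-δ} w`, where `w` is a lower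
bound for the maximal function to the power `1/q` on all of `P`; so the weight can be put inside the
integral (`volume_mul_volume_mul_measure_le`). Maximal balanced cubes overlap in null sets, and `t ↦
t^{1/q}` is subadditive, so the local bounds add up (`measure_inter_rpow_le`).

The factor `1 - δ` comes from `lintegral_edist_le_fractional`. Inserting midpoints compares the
oscillation at scale `h` with that at `h/2`; iteration bounds the total oscillation by that at every
scale `R/2^k`, and a weighted sum over `k` produces the kernel on one side and a geometric series of
size at least `1/(1-δ)` on the other.

The hypotheses on `f` and `μ` serve only to supply the dyadic density of superlevel sets and their
complements, together with the measurability and integrability of `f`. -/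

section Analysis

/-! ### Minkowski's inequality and subadditivity of powers -/

/-- Minkowski's integral inequality on a finite measure space. -/
theorem lintegral_rpow_lintegral_le {X T : Type*} [MeasurableSpace X] [MeasurableSpace T]
    (μ : Measure X) [IsFiniteMeasure μ] (ν : Measure T) [SFinite ν] {q : ℝ} (hq : 1 ≤ q)
    {F : X → T → ℝ≥0∞} (hF : Measurable (Function.uncurry F)) :
    (∫⁻ x, (∫⁻ t, F x t ∂ν) ^ q ∂μ) ^ (1 / q) ≤
      ∫⁻ t, (∫⁻ x, F x t ^ q ∂μ) ^ (1 / q) ∂ν := by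
  rcases hq.eq_or_lt with rfl | hq1
  · simp only [ENNReal.rpow_one, div_one]
    rw [lintegral_lintegral_swap hF.aemeasurable]
  have hq0 : 0 < q := by linarith
  have hpq : q.HolderConjugate (q.conjExponent) := Real.HolderConjugate.conjExponent hq1
  set p := q.conjExponent with hp
  have hGm : Measurable fun x => ∫⁻ t, F x t ∂ν := hF.lintegral_prod_right'
  set G : X → ℝ≥0∞ := fun x => ∫⁻ t, F x t ∂ν with hG
  have key : ∀ m : ℕ, (∫⁻ x, (min (G x) m) ^ q ∂μ) ^ (1 / q) ≤
      ∫⁻ t, (∫⁻ x, F x t ^ q ∂μ) ^ (1 / q) ∂ν := by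
    intro m
    -- Truncation at `m` makes `A` finite, so that `A ^ (1 / p)` can be cancelled after Hölder;
    -- monotone convergence in `m` removes it.
    set H : X → ℝ≥0∞ := fun x => min (G x) m with hH
    have hHm : Measurable H := hGm.min measurable_const
    set A := ∫⁻ x, H x ^ q ∂μ with hA
    have hAtop : A ≠ ⊤ := by
      refine ((lintegral_mono (g := fun _ => (m : ℝ≥0∞) ^ q) fun x => ?_).trans_lt ?_).ne
      · exact ENNReal.rpow_le_rpow (min_le_right _ _) hq0.le
      · rw [lintegral_const]
        exact ENNReal.mul_lt_top (ENNReal.rpow_lt_top_of_nonneg hq0.le (by simp))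
          (measure_lt_top _ _)
    by_cases hA0 : A = 0
    · rw [hA0, ENNReal.zero_rpow_of_pos (by positivity)]; exact zero_le
    have hpow : ∀ x, (H x ^ (q - 1)) ^ p = H x ^ q := fun x => by
      rw [← ENNReal.rpow_mul, hpq.sub_one_mul_conj]
    have h1 : A ≤ (∫⁻ t, (∫⁻ x, F x t ^ q ∂μ) ^ (1 / q) ∂ν) * A ^ (1 / p) := by
      calc A ≤ ∫⁻ x, H x ^ (q - 1) * G x ∂μ := by
            refine lintegral_mono fun x => ?_
            calc H x ^ q = H x ^ (q - 1) * H x := by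
                  nth_rw 3 [← ENNReal.rpow_one (H x)]
                  rw [← ENNReal.rpow_add_of_nonneg _ _ (by linarith) zero_le_one]
                  simp
              _ ≤ _ := by gcongr; exact min_le_left _ _
        _ = ∫⁻ x, ∫⁻ t, F x t * H x ^ (q - 1) ∂ν ∂μ := by
            refine lintegral_congr fun x => ?_
            have hx : Measurable fun t => F x t := hF.comp measurable_prodMk_left
            rw [lintegral_mul_const _ hx, mul_comm]
        _ = ∫⁻ t, ∫⁻ x, F x t * H x ^ (q - 1) ∂μ ∂ν := by
            refine lintegral_lintegral_swap (Measurable.aemeasurable ?_)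
            exact hF.mul ((hHm.comp measurable_fst).pow_const _)
        _ ≤ ∫⁻ t, (∫⁻ x, F x t ^ q ∂μ) ^ (1 / q) * A ^ (1 / p) ∂ν := by
            refine lintegral_mono fun t => ?_
            have := ENNReal.lintegral_mul_le_Lp_mul_Lq μ hpq (f := fun x => F x t)
              (g := fun x => H x ^ (q - 1)) (hF.comp measurable_prodMk_right).aemeasurable
              (hHm.pow_const _).aemeasurable
            simpa only [Pi.mul_apply, hpow] using this
        _ = _ := lintegral_mul_const _ ((Measurable.lintegral_prod_left'
            (f := fun z : X × T => F z.1 z.2 ^ q) (hF.pow_const q)).pow_const _)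
    have hsum : A = A ^ (1 / q) * A ^ (1 / p) := by
      rw [← ENNReal.rpow_add _ _ hA0 hAtop, one_div, one_div, hpq.inv_add_inv_eq_one,
        ENNReal.rpow_one]
    have hne : A ^ (1 / p) ≠ 0 := by simp [hA0, hAtop]
    have hnt : A ^ (1 / p) ≠ ⊤ :=
      ENNReal.rpow_ne_top_of_nonneg (one_div_nonneg.2 hpq.symm.nonneg) hAtop
    rw [hsum] at h1
    exact (ENNReal.mul_le_mul_iff_left hne hnt).1 (by rwa [← hsum, hsum])
  have hmono : (∫⁻ x, G x ^ q ∂μ) = ⨆ m : ℕ, ∫⁻ x, (min (G x) m) ^ q ∂μ := by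
    rw [← lintegral_iSup]
    · refine lintegral_congr fun x => ?_
      refine le_antisymm ?_ (iSup_le fun m => ENNReal.rpow_le_rpow (min_le_left _ _) hq0.le)
      have hs : G x = ⨆ m : ℕ, min (G x) m := by
        rw [← inf_iSup_eq, ENNReal.iSup_natCast]; simp
      have := (ENNReal.orderIsoRpow q hq0).map_iSup fun m : ℕ => min (G x) m
      simp only [ENNReal.orderIsoRpow_apply] at this
      rw [← this, ← hs]
    · exact fun m => (hGm.min measurable_const).pow_const _
    · intro a b hab x
      exact ENNReal.rpow_le_rpow (min_le_min_left _ (by exact_mod_cast hab)) hq0.le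
  have hle : ∫⁻ x, G x ^ q ∂μ ≤ (∫⁻ t, (∫⁻ x, F x t ^ q ∂μ) ^ (1 / q) ∂ν) ^ q := by
    rw [hmono]
    refine iSup_le fun m => ?_
    have := ENNReal.rpow_le_rpow (key m) hq0.le
    rwa [← ENNReal.rpow_mul, one_div_mul_cancel hq0.ne', ENNReal.rpow_one] at this
  have := ENNReal.rpow_le_rpow hle (one_div_nonneg.2 hq0.le)
  rwa [← ENNReal.rpow_mul _ q, mul_one_div_cancel hq0.ne', ENNReal.rpow_one] at this

/-- Subadditivity for two terms extends to finite sums, then to the limit by continuity. With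
exponent `1/q` it lets the estimates on separate cubes be summed. -/
theorem ENNReal.tsum_rpow_le_rpow {ι : Type*} (f : ι → ℝ≥0∞) {p : ℝ} (hp0 : 0 < p) (hp1 : p ≤ 1) :
    (∑' i, f i) ^ p ≤ ∑' i, f i ^ p := by
  have hfin : ∀ s : Finset ι, (∑ i ∈ s, f i) ^ p ≤ ∑ i ∈ s, f i ^ p := by
    intro s
    classical
    induction s using Finset.induction_on with
    | empty => simp [ENNReal.zero_rpow_of_pos hp0]
    | insert a s ha ih =>
      rw [Finset.sum_insert ha, Finset.sum_insert ha]
      exact (ENNReal.rpow_add_le_add_rpow _ _ hp0.le hp1).trans (by gcongr)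
  have ht := (ENNReal.summable (f := f)).hasSum
  have hc := (ENNReal.continuous_rpow_const (y := p)).tendsto (∑' i, f i)
  exact le_of_tendsto (hc.comp ht) (Filter.Eventually.of_forall fun s =>
    (hfin s).trans (ENNReal.sum_le_tsum s))

/-! ### The fractional Poincaré inequality with factor `1 - δ` -/

theorem measurable_edist_comp {X : Type*} [MeasurableSpace X] {f : X → ℝ} (hf : Measurable f) :
    Measurable fun z : X × X => edist (f z.1) (f z.2) :=
  (hf.comp measurable_fst).edist (hf.comp measurable_snd)

/-- A geometric sum of ratio at least `2` is at most twice its last term, and the last admissible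
`k` has `2 ^ k ≤ s`. The constant does not depend on `p`, hence later not on `δ`. -/
theorem sum_indicator_two_pow_le {p s : ℝ} (hp : 1 ≤ p) (N : ℕ) (hs : 0 ≤ s) :
    ∑ k ∈ Finset.range N, (if (2 : ℝ) ^ k ≤ s then ((2 : ℝ) ^ p) ^ k else 0) ≤ 2 * s ^ p := by
  have h2 : (2 : ℝ) ≤ 2 ^ p := by
    simpa using Real.rpow_le_rpow_of_exponent_le (x := 2) (by norm_num) hp
  have hgeom : ∀ N : ℕ, ∑ k ∈ Finset.range (N + 1), ((2 : ℝ) ^ p) ^ k ≤ 2 * (2 ^ p) ^ N := by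
    intro N
    induction N with
    | zero => simp
    | succ N ih =>
      rw [Finset.sum_range_succ]
      have : 2 * ((2 : ℝ) ^ p) ^ N ≤ (2 ^ p) ^ (N + 1) := by
        rw [pow_succ, mul_comm]; gcongr
      linarith
  induction N with
  | zero => simp; positivity
  | succ N ih =>
    by_cases h : (2 : ℝ) ^ N ≤ s
    · calc _ ≤ ∑ k ∈ Finset.range (N + 1), ((2 : ℝ) ^ p) ^ k := by
            refine Finset.sum_le_sum fun k _ => ?_
            split_ifs
            · exact le_rfl
            · positivity
        _ ≤ 2 * (2 ^ p) ^ N := hgeom N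
        _ = 2 * ((2 : ℝ) ^ N) ^ p := by
            rw [← Real.rpow_natCast, ← Real.rpow_mul (by norm_num), mul_comm p,
              Real.rpow_mul (by norm_num), Real.rpow_natCast]
        _ ≤ 2 * s ^ p := by gcongr
    · rw [Finset.sum_range_succ, if_neg h, add_zero]; exact ih

/-- Applied with `s = 1 - δ`, this turns the inverse of the geometric series into the factor `1 -
δ`. -/
theorem one_sub_two_rpow_neg_le {s : ℝ} (hs : 0 ≤ s) : 1 - (2 : ℝ) ^ (-s) ≤ s := by
  rw [Real.rpow_def_of_pos (by norm_num)]
  have h1 := Real.add_one_le_exp (Real.log 2 * -s)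
  have h2 : Real.log 2 ≤ 1 := (Real.log_le_sub_one_of_pos (by norm_num)).trans (by norm_num)
  nlinarith

/-- The kernel `|x - y|⁻ᵖ`, with value `0` on the diagonal. -/
noncomputable def invDistKernel {E : Type*} [NormedAddCommGroup E] (p : ℝ) (x y : E) : ℝ≥0∞ := ENNReal.ofReal ((‖x - y‖ ^ p)⁻¹)

/-- A pair `x ≠ y` is counted exactly at the scales with `2 ^ k ≤ R / ‖x - y‖`, so the weights `2 ^
(p k)` add up to a multiple of `(R / ‖x - y‖) ^ p`. -/
theorem tsum_oscKernel_le {E : Type*} [NormedAddCommGroup E] {f : E → ℝ} {p R : ℝ} (hp : 1 ≤ p) (hR : 0 < R) (x y : E) :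
    ∑' k : ℕ, ENNReal.ofReal (((2 : ℝ) ^ p) ^ k) *
      {z : E × E | dist z.1 z.2 ≤ R / 2 ^ k}.indicator (fun z => edist (f z.1) (f z.2)) (x, y) ≤
    ENNReal.ofReal (2 * R ^ p) * (edist (f x) (f y) * invDistKernel p x y) := by
  by_cases hxy : x = y
  · simp [hxy, Set.indicator_apply]
  have hr : 0 < ‖x - y‖ := norm_pos_iff.2 (sub_ne_zero.2 hxy)
  refine ENNReal.summable.tsum_le_of_sum_range_le fun N => ?_
  have h := sum_indicator_two_pow_le hp N (s := R / ‖x - y‖) (by positivity)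
  have h3 : ∀ k ∈ Finset.range N, ENNReal.ofReal (((2 : ℝ) ^ p) ^ k) *
      {z : E × E | dist z.1 z.2 ≤ R / 2 ^ k}.indicator (fun z => edist (f z.1) (f z.2)) (x, y) =
      ENNReal.ofReal (if (2 : ℝ) ^ k ≤ R / ‖x - y‖ then ((2 : ℝ) ^ p) ^ k else 0) *
        edist (f x) (f y) := by
    intro k _
    have : (dist x y ≤ R / 2 ^ k) ↔ (2 : ℝ) ^ k ≤ R / ‖x - y‖ := by
      rw [dist_eq_norm, le_div_iff₀ (by positivity), le_div_iff₀ hr, mul_comm]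
    simp only [Set.indicator_apply, Set.mem_ofPred_eq, this]
    split_ifs <;> simp
  rw [Finset.sum_congr rfl h3, ← Finset.sum_mul, ← ENNReal.ofReal_sum_of_nonneg, invDistKernel,
    mul_left_comm, mul_comm, ← ENNReal.ofReal_mul (by positivity)]
  · gcongr
    refine h.trans_eq ?_
    rw [Real.div_rpow hR.le hr.le]; ring
  · intro k _; split_ifs <;> positivity

variable {E : Type*} [NormedAddCommGroup E] [NormedSpace ℝ E] [MeasurableSpace E] [BorelSpace E]
  [FiniteDimensional ℝ E] (ν : Measure E) [ν.IsAddHaarMeasure]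

theorem lintegral_comp_midpoint (x : E) {G : E → ℝ≥0∞} (hG : Measurable G) :
    ∫⁻ y, G (midpoint ℝ x y) ∂ν = 2 ^ Module.finrank ℝ E * ∫⁻ y, G y ∂ν := by
  have h1 : ∀ y, G (midpoint ℝ x y) = (fun z => G ((2⁻¹ : ℝ) • z)) (x + y) := fun y => by
    simp [midpoint_eq_smul_add]
  simp_rw [h1]
  rw [lintegral_add_left_eq_self (fun z => G ((2⁻¹ : ℝ) • z)) x,
    ← lintegral_map hG (measurable_const_smul (2⁻¹ : ℝ)),
    Measure.map_addHaar_smul ν (by norm_num : (2⁻¹ : ℝ) ≠ 0), lintegral_smul_measure]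
  congr 1
  rw [inv_pow, inv_inv, abs_of_pos (by positivity), ENNReal.ofReal_pow (by norm_num)]
  simp

/-- The oscillation of `f` over pairs of points of `S` at distance at most `h`. -/
noncomputable def oscWithin (S : Set E) (f : E → ℝ) (h : ℝ) : ℝ≥0∞ :=
  ∫⁻ x in S, ∫⁻ y in S, {z : E × E | dist z.1 z.2 ≤ h}.indicator
    (fun z => edist (f z.1) (f z.2)) (x, y) ∂ν ∂ν

theorem measurable_oscKernel {f : E → ℝ} (hf : Measurable f) (h : ℝ) :
    Measurable ({z : E × E | dist z.1 z.2 ≤ h}.indicator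
      (fun z => edist (f z.1) (f z.2))) := by
  have : ProperSpace E := FiniteDimensional.proper ℝ E
  refine (measurable_edist_comp hf).indicator ?_
  exact measurableSet_le (measurable_fst.dist measurable_snd) measurable_const

/-- By the triangle inequality through the midpoint, a pair at distance at most `h` is replaced by
two pairs at distance at most `h / 2`. The substitution `y ↦ midpoint x y` costs `2 ^ n` with `n`
the dimension, and the two pairs give the remaining factor `2`. -/
theorem oscWithin_le_half {S : Set E} (hS : Convex ℝ S) (hSm : MeasurableSet S)
    {f : E → ℝ} (hf : Measurable f) (h : ℝ) :
    oscWithin ν S f h ≤ 2 ^ (Module.finrank ℝ E + 1) * oscWithin ν S f (h / 2) := by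
  set H : ℝ → E × E → ℝ≥0∞ := fun h => {z : E × E | dist z.1 z.2 ≤ h}.indicator
      (fun z => edist (f z.1) (f z.2)) with hH
  have hHm : ∀ h, Measurable (H h) := measurable_oscKernel hf
  have : ProperSpace E := FiniteDimensional.proper ℝ E
  have hmid : Measurable fun z : E × E => midpoint ℝ z.1 z.2 := by
    simp only [midpoint_eq_smul_add]
    exact (measurable_fst.add measurable_snd).const_smul _
  have htri : ∀ x y, H h (x, y) ≤ H (h / 2) (x, midpoint ℝ x y) + H (h / 2) (y, midpoint ℝ x y) := by
    intro x y
    by_cases hxy : dist x y ≤ h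
    · have e1 : dist x (midpoint ℝ x y) ≤ h / 2 := by
        rw [dist_left_midpoint]; norm_num; linarith
      have e2 : dist y (midpoint ℝ x y) ≤ h / 2 := by
        rw [dist_right_midpoint]; norm_num; linarith
      simp only [hH, Set.indicator_apply, Set.mem_ofPred_eq, hxy, e1, e2, if_true]
      exact edist_triangle_right _ _ _
    · simp [hH, Set.indicator_apply, hxy]
  have hone : ∀ x ∈ S, ∫⁻ y in S, H (h / 2) (x, midpoint ℝ x y) ∂ν ≤
      2 ^ Module.finrank ℝ E * ∫⁻ y in S, H (h / 2) (x, y) ∂ν := by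
    intro x hx
    have hx' : Measurable fun y => H (h / 2) (x, y) := (hHm _).comp measurable_prodMk_left
    rw [← lintegral_indicator hSm, ← lintegral_indicator hSm,
      ← lintegral_comp_midpoint ν x (hx'.indicator hSm)]
    -- Convexity enters here: `y ∈ S` forces the midpoint into `S`.
    refine lintegral_mono fun y => ?_
    by_cases hy : y ∈ S
    · simp [Set.indicator_of_mem, hy, hS.midpoint_mem hx hy]
    · simp [hy]
  have hA : ∫⁻ x in S, ∫⁻ y in S, H (h / 2) (x, midpoint ℝ x y) ∂ν ∂ν ≤
      2 ^ Module.finrank ℝ E * oscWithin ν S f (h / 2) := by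
    unfold oscWithin
    rw [← lintegral_const_mul' _ _ (by simp)]
    exact setLIntegral_mono' hSm hone
  calc oscWithin ν S f h = ∫⁻ x in S, ∫⁻ y in S, H h (x, y) ∂ν ∂ν := rfl
    _ ≤ ∫⁻ x in S, ∫⁻ y in S, (H (h / 2) (x, midpoint ℝ x y) +
          H (h / 2) (y, midpoint ℝ x y)) ∂ν ∂ν :=
        lintegral_mono fun x => lintegral_mono fun y => htri x y
    _ = ∫⁻ x in S, ∫⁻ y in S, H (h / 2) (x, midpoint ℝ x y) ∂ν ∂ν +
          ∫⁻ x in S, ∫⁻ y in S, H (h / 2) (y, midpoint ℝ x y) ∂ν ∂ν := by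
        have hm1 : Measurable fun z : E × E => H (h / 2) (z.1, midpoint ℝ z.1 z.2) :=
          (hHm _).comp (measurable_fst.prodMk hmid)
        rw [← lintegral_add_left hm1.lintegral_prod_right']
        refine lintegral_congr fun x => ?_
        exact lintegral_add_left (hm1.comp measurable_prodMk_left) _
    _ = ∫⁻ x in S, ∫⁻ y in S, H (h / 2) (x, midpoint ℝ x y) ∂ν ∂ν +
          ∫⁻ x in S, ∫⁻ y in S, H (h / 2) (x, midpoint ℝ x y) ∂ν ∂ν := by
        congr 1
        rw [lintegral_lintegral_swap]
        · simp_rw [midpoint_comm]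
        · exact ((hHm _).comp (measurable_snd.prodMk hmid)).aemeasurable
    _ ≤ _ := (add_le_add hA hA).trans_eq (by ring)

theorem measurable_invDistKernel (p : ℝ) :
    Measurable fun z : E × E => invDistKernel p z.1 z.2 := by
  have : ProperSpace E := FiniteDimensional.proper ℝ E
  unfold invDistKernel
  exact ((((measurable_fst.sub measurable_snd).norm).pow_const p).inv).ennreal_ofReal

/-- A fractional Poincaré inequality on convex sets with the factor `1 - δ`. -/
theorem lintegral_edist_le_fractional {S : Set E} (hS : Convex ℝ S) (hSm : MeasurableSet S)
    {f : E → ℝ} (hf : Measurable f) {R δ : ℝ} (hR : 0 < R)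
    (hdiam : ∀ x ∈ S, ∀ y ∈ S, dist x y ≤ R) (hE : 1 ≤ Module.finrank ℝ E)
    (hδ0 : 0 ≤ δ) (hδ1 : δ < 1) :
    ∫⁻ x in S, ∫⁻ y in S, edist (f x) (f y) ∂ν ∂ν ≤
      ENNReal.ofReal ((1 - δ) * (2 * R ^ (Module.finrank ℝ E + δ))) *
        ∫⁻ x in S, ∫⁻ y in S,
          edist (f x) (f y) * invDistKernel (Module.finrank ℝ E + δ) x y ∂ν ∂ν := by
  set n := Module.finrank ℝ E with hn
  have hn1 : (1 : ℝ) ≤ n := by exact_mod_cast hE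
  set p : ℝ := n + δ with hp
  have hp1 : 1 ≤ p := by linarith
  set B := ∫⁻ x in S, ∫⁻ y in S, edist (f x) (f y) ∂ν ∂ν with hB
  set Φ := ∫⁻ x in S, ∫⁻ y in S, edist (f x) (f y) * invDistKernel p x y ∂ν ∂ν with hΦ
  have hB0 : B ≤ oscWithin ν S f R := by
    refine setLIntegral_mono' hSm fun x hx => setLIntegral_mono' hSm fun y hy => ?_
    rw [Set.indicator_of_mem]
    exact hdiam x hx y hy
  have hBk : ∀ k : ℕ, B ≤ (2 ^ (n + 1)) ^ k * oscWithin ν S f (R / 2 ^ k) := by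
    intro k
    induction k with
    | zero => simpa using hB0
    | succ k ih =>
      refine ih.trans ?_
      rw [pow_succ _ k, mul_assoc, pow_succ (2 : ℝ) k, ← div_div]
      gcongr
      exact oscWithin_le_half ν hS hSm hf _
  -- Chosen so that `b * 2 ^ (n + 1) = 2 ^ p`; it is below `1` exactly because `δ < 1`.
  set b : ℝ := 2 ^ (-(1 - δ)) with hb
  have hb0 : 0 < b := by positivity
  have hb1 : b < 1 := Real.rpow_lt_one_of_one_lt_of_neg (by norm_num) (by linarith)
  have hstep : ∀ k : ℕ, ENNReal.ofReal b ^ k * B ≤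
      ENNReal.ofReal (((2 : ℝ) ^ p) ^ k) * oscWithin ν S f (R / 2 ^ k) := by
    intro k
    calc ENNReal.ofReal b ^ k * B ≤
        ENNReal.ofReal b ^ k * ((2 ^ (n + 1)) ^ k * oscWithin ν S f (R / 2 ^ k)) := by
          gcongr; exact hBk k
      _ = _ := by
          rw [← mul_assoc, ← mul_pow, ENNReal.ofReal_pow (by positivity)]
          congr 2
          have : (2 : ℝ≥0∞) ^ (n + 1) = ENNReal.ofReal (2 ^ (n + 1)) := by
            rw [ENNReal.ofReal_pow (by norm_num)]; simp
          rw [this, ← ENNReal.ofReal_mul hb0.le, hb, ← Real.rpow_natCast,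
            ← Real.rpow_add (by norm_num)]
          congr 2
          push_cast; ring
  -- Sum `hstep` over all scales: a geometric series on the left, the kernel `|x - y|⁻ᵖ` on the
  -- right.
  have hsum : (1 - ENNReal.ofReal b)⁻¹ * B ≤ ENNReal.ofReal (2 * R ^ p) * Φ := by
    rw [← ENNReal.tsum_geometric, ← ENNReal.tsum_mul_right]
    refine (ENNReal.tsum_le_tsum hstep).trans ?_
    have hm := fun k : ℕ => measurable_oscKernel hf (R / 2 ^ k)
    simp only [oscWithin]
    have e1 : ∀ k : ℕ, ENNReal.ofReal (((2 : ℝ) ^ p) ^ k) *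
        (∫⁻ x in S, ∫⁻ y in S, {z : E × E | dist z.1 z.2 ≤ R / 2 ^ k}.indicator
          (fun z => edist (f z.1) (f z.2)) (x, y) ∂ν ∂ν) =
        ∫⁻ x in S, ∫⁻ y in S, ENNReal.ofReal (((2 : ℝ) ^ p) ^ k) *
          {z : E × E | dist z.1 z.2 ≤ R / 2 ^ k}.indicator
          (fun z => edist (f z.1) (f z.2)) (x, y) ∂ν ∂ν := fun k => by
      simp_rw [lintegral_const_mul' _ _ ENNReal.ofReal_ne_top]
    simp_rw [e1]
    rw [← lintegral_tsum fun k => ((hm k).const_mul _).lintegral_prod_right'.aemeasurable, hΦ,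
      ← lintegral_const_mul' _ _ ENNReal.ofReal_ne_top]
    refine lintegral_mono fun x => ?_
    have hx' := fun k : ℕ => (((hm k).const_mul (ENNReal.ofReal (((2 : ℝ) ^ p) ^ k))).comp
      (measurable_prodMk_left (x := x))).aemeasurable (μ := ν.restrict S)
    simp only [Function.comp_def] at hx'
    rw [← lintegral_tsum hx',
      ← lintegral_const_mul' _ _ ENNReal.ofReal_ne_top]
    exact lintegral_mono fun y => tsum_oscKernel_le hp1 hR x y
  have hbne : (1 - ENNReal.ofReal b) ≠ 0 := by
    rw [← ENNReal.ofReal_one, ← ENNReal.ofReal_sub _ hb0.le]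
    simpa using hb1
  have hbt : (1 - ENNReal.ofReal b) ≠ ⊤ := by
    exact ENNReal.sub_ne_top ENNReal.one_ne_top
  calc B = (1 - ENNReal.ofReal b) * ((1 - ENNReal.ofReal b)⁻¹ * B) := by
        rw [← mul_assoc, ENNReal.mul_inv_cancel hbne hbt, one_mul]
    _ ≤ ENNReal.ofReal (1 - δ) * (ENNReal.ofReal (2 * R ^ p) * Φ) := by
        gcongr
        rw [← ENNReal.ofReal_one, ← ENNReal.ofReal_sub _ hb0.le]
        refine ENNReal.ofReal_le_ofReal (one_sub_two_rpow_neg_le (by linarith))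
    _ = _ := by rw [← mul_assoc, ← ENNReal.ofReal_mul (by linarith)]

end Analysis

/-! ### Geometry of cubes and the dyadic grid -/

namespace Cube

variable {n : ℕ} (Q : Cube n)

theorem toSet_eq_preimage : Q.toSet =
    WithLp.ofLp ⁻¹' Set.Icc (fun i => Q.corner i) (fun i => Q.corner i + Q.side) := by
  ext x
  simp [toSet, Set.mem_Icc, Pi.le_def, forall_and]

theorem isCompact_toSet : IsCompact Q.toSet := by
  rw [toSet_eq_preimage]
  exact (EuclideanSpace.equiv (Fin n) ℝ).toHomeomorph.isCompact_preimage.2 isCompact_Icc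

theorem measurableSet_toSet : MeasurableSet Q.toSet := Q.isCompact_toSet.isClosed.measurableSet

theorem convex_toSet : Convex ℝ Q.toSet := by
  rw [toSet_eq_preimage]
  exact (convex_Icc _ _).linear_preimage (EuclideanSpace.equiv (Fin n) ℝ).toLinearMap

theorem volume_toSet : volume Q.toSet = ENNReal.ofReal (Q.side ^ n) := by
  rw [toSet_eq_preimage, (PiLp.volume_preserving_ofLp (Fin n)).measure_preimage
    measurableSet_Icc.nullMeasurableSet, Real.volume_Icc_pi]
  simp [ENNReal.ofReal_pow Q.side_pos.le]

theorem volume_toSet_ne_zero : volume Q.toSet ≠ 0 := by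
  rw [volume_toSet]
  simpa using pow_pos Q.side_pos n

theorem volume_toSet_ne_top : volume Q.toSet ≠ ⊤ := by
  rw [volume_toSet]; exact ENNReal.ofReal_ne_top

theorem dist_le_of_mem_toSet (hn : 1 ≤ n) {x y : EuclideanSpace ℝ (Fin n)} (hx : x ∈ Q.toSet)
    (hy : y ∈ Q.toSet) : dist x y ≤ n * Q.side := by
  have hn' : (1 : ℝ) ≤ n := by exact_mod_cast hn
  have hs := Q.side_pos
  rw [EuclideanSpace.dist_eq, Real.sqrt_le_left (by positivity)]
  calc ∑ i, dist (x i) (y i) ^ 2 ≤ ∑ _i : Fin n, Q.side ^ 2 := by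
        refine Finset.sum_le_sum fun i _ => ?_
        have : dist (x i) (y i) ≤ Q.side := by
          rw [Real.dist_eq, abs_le]
          constructor <;> linarith [(hx i).1, (hx i).2, (hy i).1, (hy i).2]
        gcongr
    _ = n * Q.side ^ 2 := by simp
    _ ≤ (n * Q.side) ^ 2 := by
        rw [mul_pow]
        gcongr
        nlinarith

theorem mem_dyadicSubcube {k : ℕ} {m : Fin n → Fin (2 ^ k)} {x : EuclideanSpace ℝ (Fin n)} :
    x ∈ (Q.dyadicSubcube k m).toSet ↔
      ∀ i, Q.corner i + (m i : ℕ) * (Q.side / 2 ^ k) ≤ x i ∧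
        x i ≤ Q.corner i + (m i : ℕ) * (Q.side / 2 ^ k) + Q.side / 2 ^ k := Iff.rfl

theorem dyadicSubcube_side (k : ℕ) (m : Fin n → Fin (2 ^ k)) :
    (Q.dyadicSubcube k m).side = Q.side / 2 ^ k := rfl

theorem dyadicSubcube_zero_toSet (m : Fin n → Fin (2 ^ 0)) :
    (Q.dyadicSubcube 0 m).toSet = Q.toSet := by
  ext x
  rw [mem_dyadicSubcube]
  simp [toSet]

/-- The grid position of the generation `j` ancestor of a dyadic cube of generation `k`. -/
def ancestor {k j : ℕ} (h : j ≤ k) (m : Fin n → Fin (2 ^ k)) : Fin n → Fin (2 ^ j) := fun i =>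
  ⟨m i / 2 ^ (k - j), by
    rw [Nat.div_lt_iff_lt_mul (by positivity), ← pow_add, Nat.add_sub_cancel' h]
    exact (m i).2⟩

theorem dyadicSubcube_subset_ancestor {k j : ℕ} (h : j ≤ k) (m : Fin n → Fin (2 ^ k)) :
    (Q.dyadicSubcube k m).toSet ⊆ (Q.dyadicSubcube j (ancestor h m)).toSet := by
  intro x hx i
  have hx := (Q.mem_dyadicSubcube.1 hx) i
  obtain ⟨d, rfl⟩ := Nat.exists_eq_add_of_le h
  have hs := Q.side_pos
  have hside : Q.side / 2 ^ j = 2 ^ d * (Q.side / 2 ^ (j + d)) := by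
    rw [pow_add]; field_simp
  have h1 : ((m i / 2 ^ d : ℕ) : ℝ) * 2 ^ d ≤ (m i : ℕ) := by
    exact_mod_cast Nat.div_mul_le_self _ _
  have h2 : ((m i : ℕ) : ℝ) + 1 ≤ ((m i / 2 ^ d : ℕ) + 1) * 2 ^ d := by
    have := Nat.lt_div_mul_add (a := (m i : ℕ)) (b := 2 ^ d) (by positivity)
    have h3 : (m i : ℕ) + 1 ≤ (m i / 2 ^ d + 1) * 2 ^ d := by rw [add_mul, one_mul]; omega
    exact_mod_cast h3
  set t := Q.side / 2 ^ (j + d) with ht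
  have ht0 : 0 < t := by positivity
  have hanc : ((ancestor h m i : ℕ) : ℝ) = ((m i / 2 ^ d : ℕ) : ℝ) := by simp [ancestor]
  change Q.corner i + ((ancestor h m i : ℕ) : ℝ) * (Q.side / 2 ^ j) ≤ x i ∧
    x i ≤ Q.corner i + ((ancestor h m i : ℕ) : ℝ) * (Q.side / 2 ^ j) + Q.side / 2 ^ j
  rw [hanc, hside]
  constructor
  · nlinarith [hx.1, mul_le_mul_of_nonneg_right h1 ht0.le]
  · nlinarith [hx.2, mul_le_mul_of_nonneg_right h2 ht0.le]

theorem dyadicSubcube_subset (k : ℕ) (m : Fin n → Fin (2 ^ k)) :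
    (Q.dyadicSubcube k m).toSet ⊆ Q.toSet := by
  rw [← Q.dyadicSubcube_zero_toSet (ancestor (Nat.zero_le k) m)]
  exact Q.dyadicSubcube_subset_ancestor _ m

theorem exists_mem_dyadicSubcube (k : ℕ) {x : EuclideanSpace ℝ (Fin n)} (hx : x ∈ Q.toSet) :
    ∃ m : Fin n → Fin (2 ^ k), x ∈ (Q.dyadicSubcube k m).toSet := by
  have hs := Q.side_pos
  set t := Q.side / 2 ^ k with ht
  have ht0 : 0 < t := by positivity
  have hside : Q.side = 2 ^ k * t := by rw [ht]; field_simp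
  have hk : 0 < 2 ^ k := by positivity
  have : ∀ i, ∃ a : Fin (2 ^ k), Q.corner i + (a : ℕ) * t ≤ x i ∧
      x i ≤ Q.corner i + (a : ℕ) * t + t := by
    intro i
    obtain ⟨h1, h2⟩ := hx i
    set u := (x i - Q.corner i) / t with hu
    have hxu : x i = Q.corner i + u * t := by rw [hu]; field_simp; ring
    have hu0 : 0 ≤ u := div_nonneg (by linarith) ht0.le
    by_cases hlt : ⌊u⌋₊ < 2 ^ k
    · refine ⟨⟨⌊u⌋₊, hlt⟩, ?_, ?_⟩
      · rw [hxu]; gcongr; exact Nat.floor_le hu0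
      · rw [hxu]; nlinarith [Nat.lt_floor_add_one u]
    -- Here `x i` is on the upper face of `Q`, where the floor overshoots by one; the last interval
    -- contains it.
    · refine ⟨⟨2 ^ k - 1, by omega⟩, ?_, ?_⟩
      · rw [hxu]
        gcongr
        have : ((2 ^ k - 1 : ℕ) : ℝ) ≤ (⌊u⌋₊ : ℕ) := by exact_mod_cast (by omega)
        exact this.trans (Nat.floor_le hu0)
      · simp only [Nat.cast_sub (Nat.one_le_two_pow (n := k))]
        push_cast
        linarith
  choose m hm using this
  exact ⟨m, hm⟩

theorem volume_hyperplane (i : Fin n) (c : ℝ) :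
    volume {x : EuclideanSpace ℝ (Fin n) | x i = c} = 0 := by
  have h : {x : EuclideanSpace ℝ (Fin n) | x i = c} =
    WithLp.ofLp ⁻¹' {y : Fin n → ℝ | y i = c} := rfl
  rw [h, (PiLp.volume_preserving_ofLp (Fin n)).measure_preimage
    (measurableSet_eq_fun (measurable_pi_apply i) measurable_const).nullMeasurableSet]
  exact Measure.pi_hyperplane (fun _ : Fin n => (volume : Measure ℝ)) i c

/-- In a coordinate where the positions differ, the two closed cubes share at most a hyperplane.
This is null for Lebesgue measure but perhaps not for `μ`; disjointness is needed only for the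
energy, a Lebesgue integral in the outer variable. -/
theorem aedisjoint_dyadicSubcube_of_ne {k : ℕ} {m m' : Fin n → Fin (2 ^ k)} (h : m ≠ m') :
    AEDisjoint volume (Q.dyadicSubcube k m).toSet (Q.dyadicSubcube k m').toSet := by
  have hs := Q.side_pos
  have ht0 : 0 < Q.side / 2 ^ k := by positivity
  obtain ⟨i, hi⟩ := Function.ne_iff.1 h
  wlog hlt : (m i : ℕ) < m' i generalizing m m'
  · refine (this h.symm hi.symm ?_).symm
    have : (m i : ℕ) ≠ m' i := fun h' => hi (Fin.ext h')
    omega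
  refine measure_mono_null (fun x hx => ?_)
    (volume_hyperplane i (Q.corner i + (m' i : ℕ) * (Q.side / 2 ^ k)))
  have h1 := (Q.mem_dyadicSubcube.1 hx.1 i).2
  have h2 := (Q.mem_dyadicSubcube.1 hx.2 i).1
  have h3 : ((m i : ℕ) : ℝ) + 1 ≤ (m' i : ℕ) := by exact_mod_cast hlt
  refine le_antisymm ?_ h2
  nlinarith [mul_le_mul_of_nonneg_right h3 ht0.le]

/-- Compare `m'` with the generation `j` ancestor of `m`: it is either that ancestor or a different
cube of the same generation. -/
theorem aedisjoint_or_subset {j k : ℕ} (h : j ≤ k) (m' : Fin n → Fin (2 ^ j))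
    (m : Fin n → Fin (2 ^ k)) :
    AEDisjoint volume (Q.dyadicSubcube j m').toSet (Q.dyadicSubcube k m).toSet ∨
      (Q.dyadicSubcube k m).toSet ⊆ (Q.dyadicSubcube j m').toSet := by
  by_cases hm : m' = ancestor h m
  · exact Or.inr (hm ▸ Q.dyadicSubcube_subset_ancestor h m)
  · exact Or.inl ((Q.aedisjoint_dyadicSubcube_of_ne hm).mono le_rfl
      (Q.dyadicSubcube_subset_ancestor h m))

/-! ### Maximal and balanced dyadic cubes -/

/-- Index set of all dyadic subcubes: generation and grid position. -/
abbrev DyadicIndex (n : ℕ) := Σ k : ℕ, (Fin n → Fin (2 ^ k))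

/-- The dyadic subcube with a given index. -/
noncomputable abbrev dyadic (s : DyadicIndex n) : Cube n := Q.dyadicSubcube s.1 s.2

theorem dyadic_mem_dyadicSubcubes (s : DyadicIndex n) : Q.dyadic s ∈ Q.dyadicSubcubes :=
  Set.mem_iUnion.2 ⟨s.1, Set.mem_range_self _⟩

/-- `s` is a maximal dyadic cube among those satisfying `G`. -/
def IsMaximalDyadic (G : DyadicIndex n → Prop) (s : DyadicIndex n) : Prop :=
  G s ∧ ∀ s', G s' → s'.1 < s.1 → ¬ (Q.dyadic s).toSet ⊆ (Q.dyadic s').toSet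

/-- Passing to a larger admissible cube strictly lowers the generation, so the process stops. -/
theorem exists_isMaximalDyadic (G : DyadicIndex n → Prop) {s : DyadicIndex n} (hs : G s) :
    ∃ s', Q.IsMaximalDyadic G s' ∧ (Q.dyadic s).toSet ⊆ (Q.dyadic s').toSet := by
  induction hk : s.1 using Nat.strong_induction_on generalizing s with
  | _ k ih =>
    by_cases hmax : Q.IsMaximalDyadic G s
    · exact ⟨s, hmax, subset_rfl⟩
    · simp only [IsMaximalDyadic, hs, true_and, not_forall, not_not] at hmax
      obtain ⟨s', hG, hlt, hsub⟩ := hmax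
      obtain ⟨t, ht, hst⟩ := ih s'.1 (hk ▸ hlt) hG rfl
      exact ⟨t, ht, hsub.trans hst⟩

/-- Were the overlap not null, the finer cube would lie in the coarser one, against its maximality.
-/
theorem IsMaximalDyadic.aedisjoint {G : DyadicIndex n → Prop} {s t : DyadicIndex n}
    (hs : Q.IsMaximalDyadic G s) (ht : Q.IsMaximalDyadic G t) (hne : s ≠ t) :
    AEDisjoint volume (Q.dyadic s).toSet (Q.dyadic t).toSet := by
  wlog hle : s.1 ≤ t.1 generalizing s t
  · exact (this ht hs hne.symm (le_of_not_ge hle)).symm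
  rcases hle.eq_or_lt with h | h
  · obtain ⟨k, m⟩ := s
    obtain ⟨k', m'⟩ := t
    obtain rfl : k = k' := h
    exact Q.aedisjoint_dyadicSubcube_of_ne fun h' => hne (congrArg _ h')
  · exact (Q.aedisjoint_or_subset hle s.2 t.2).resolve_right (ht.2 s hs.1 h)

/-- A cube in which `E` occupies between `2⁻ⁿ⁻¹` and `1/2` of the volume. -/
def IsBalanced (E : Set (EuclideanSpace ℝ (Fin n))) (P : Cube n) : Prop :=
  volume P.toSet ≤ 2 ^ (n + 1) * volume (E ∩ P.toSet) ∧
    2 * volume (E ∩ P.toSet) ≤ volume P.toSet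

/-- Every dyadic cube more than half filled by `E` lies in a balanced one. -/
theorem exists_isBalanced {E : Set (EuclideanSpace ℝ (Fin n))}
    (hE : 2 * volume (E ∩ Q.toSet) ≤ volume Q.toSet) (s : DyadicIndex n)
    (hs : volume (Q.dyadic s).toSet < 2 * volume (E ∩ (Q.dyadic s).toSet)) :
    ∃ t, IsBalanced E (Q.dyadic t) ∧ (Q.dyadic s).toSet ⊆ (Q.dyadic t).toSet := by
  obtain ⟨k, m⟩ := s
  induction k with
  | zero =>
    simp only [dyadic, dyadicSubcube_zero_toSet] at hs
    exact absurd hE (not_le.2 hs)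
  | succ k ih =>
    have hsub := Q.dyadicSubcube_subset_ancestor (Nat.le_succ k) m
    set t : DyadicIndex n := ⟨k, ancestor (Nat.le_succ k) m⟩ with ht
    -- Either the parent is at most half filled, and then it is balanced because its more than half
    -- filled child has `2⁻ⁿ` of its volume; or the climb continues. It ends by generation `0`,
    -- where `hE` applies.
    rcases le_or_gt (2 * volume (E ∩ (Q.dyadic t).toSet)) (volume (Q.dyadic t).toSet) with h | h
    · refine ⟨t, ⟨?_, h⟩, hsub⟩
      have hv : volume (Q.dyadic t).toSet = 2 ^ n * volume (Q.dyadicSubcube (k + 1) m).toSet := by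
        rw [volume_toSet, volume_toSet, dyadicSubcube_side, dyadicSubcube_side]
        have : (2 : ℝ≥0∞) ^ n = ENNReal.ofReal (2 ^ n) := by
          rw [ENNReal.ofReal_pow (by norm_num)]; simp
        rw [this, ← ENNReal.ofReal_mul (by positivity), ← mul_pow]
        congr 2
        rw [ht, pow_succ]; field_simp
      rw [hv, pow_succ, mul_assoc]
      gcongr
      refine hs.le.trans ?_
      gcongr
    · obtain ⟨t', h1, h2⟩ := ih t.2 h
      exact ⟨t', h1, hsub.trans h2⟩

end Cube

/-! ### The weighted inequality for characteristic functions -/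

section Poincare

variable {n : ℕ}

/-- `|1_E(x) - 1_E(y)|`. -/
noncomputable def charEdist {X : Type*} (E : Set X) (x y : X) : ℝ≥0∞ :=
  edist (E.indicator (fun _ => (1 : ℝ)) x) (E.indicator (fun _ => (1 : ℝ)) y)

theorem charEdist_compl {X : Type*} (E : Set X) (x y : X) :
    charEdist Eᶜ x y = charEdist E x y := by
  by_cases hx : x ∈ E <;> by_cases hy : y ∈ E <;> simp [charEdist, hx, hy, edist_comm]

theorem charEdist_le {X : Type*} (E : Set X) (x y : X) :
    charEdist E x y ≤ E.indicator 1 x + E.indicator 1 y := by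
  by_cases hx : x ∈ E <;> by_cases hy : y ∈ E <;> simp [charEdist, hx, hy, edist_dist]

/-- The integrand is `1` exactly when `t` separates the two values, that is on an interval of length
`|f x - f y|`. -/
theorem lintegral_charEdist_superlevel {X : Type*} (f : X → ℝ) (x y : X) :
    ∫⁻ t : ℝ, charEdist {z | t < f z} x y = edist (f x) (f y) := by
  have h : (fun t : ℝ => charEdist {z | t < f z} x y) =
      (Set.Ico (min (f x) (f y)) (max (f x) (f y))).indicator 1 := by
    ext t
    by_cases hx : t < f x <;> by_cases hy : t < f y <;>
      simp [charEdist, Set.indicator_apply, hx, hy, edist_dist]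
  rw [h, lintegral_indicator_one measurableSet_Ico, Real.volume_Ico, max_sub_min_eq_abs',
    edist_dist, Real.dist_eq]

/-- The right hand side of the weighted inequality, without the constant, over a subset `S` of `Q`
in the outer variable. -/
noncomputable def weightedEnergy (p q α : ℝ) (Q : Cube n) (μ : Measure (EuclideanSpace ℝ (Fin n)))
    (S : Set (EuclideanSpace ℝ (Fin n)))
    (g : EuclideanSpace ℝ (Fin n) → EuclideanSpace ℝ (Fin n) → ℝ≥0∞) : ℝ≥0∞ :=
  ∫⁻ x in S, (∫⁻ y in Q.toSet, g x y * invDistKernel p x y) *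
    dyadicFracMaximal α Q μ x ^ (1 / q)

theorem le_dyadicFracMaximal (α : ℝ) (Q : Cube n) (μ : Measure (EuclideanSpace ℝ (Fin n)))
    (s : Cube.DyadicIndex n) {x : EuclideanSpace ℝ (Fin n)} (hx : x ∈ (Q.dyadic s).toSet) :
    ENNReal.ofReal ((Q.dyadic s).side ^ α) *
      (μ (Q.dyadic s).toSet / volume (Q.dyadic s).toSet) ≤ dyadicFracMaximal α Q μ x :=
  le_iSup₂_of_le (Q.dyadic s) (Q.dyadic_mem_dyadicSubcubes s) (le_iSup_of_le hx le_rfl)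

theorem measurable_dyadicFracMaximal (α : ℝ) (Q : Cube n)
    (μ : Measure (EuclideanSpace ℝ (Fin n))) : Measurable (dyadicFracMaximal α Q μ) := by
  have hc : Q.dyadicSubcubes.Countable :=
    Set.countable_iUnion fun k => Set.countable_range _
  unfold dyadicFracMaximal
  refine Measurable.biSup _ hc fun P _ => ?_
  have : (fun x => ⨆ (_ : x ∈ P.toSet), ENNReal.ofReal (P.side ^ α) *
      (μ P.toSet / volume P.toSet)) =
      P.toSet.indicator (fun _ => ENNReal.ofReal (P.side ^ α) * (μ P.toSet / volume P.toSet)) := by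
    ext x
    by_cases hx : x ∈ P.toSet <;> simp [hx]
  rw [this]
  exact measurable_const.indicator P.measurableSet_toSet

/-- Isoperimetric inequality for `E` relative to a dyadic cube, weighted by the measure of the
cube. -/
theorem volume_mul_volume_mul_measure_le (hn : 1 ≤ n) {δ q α : ℝ} (hδ0 : 0 ≤ δ) (hδ1 : δ < 1)
    (hq : 1 ≤ q) (hα : α = n - q * (n - δ)) (Q : Cube n)
    (μ : Measure (EuclideanSpace ℝ (Fin n)))
    {E : Set (EuclideanSpace ℝ (Fin n))} (hE : MeasurableSet E) (s : Cube.DyadicIndex n) :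
    volume (E ∩ (Q.dyadic s).toSet) * volume ((Q.dyadic s).toSet \ E) *
        μ (Q.dyadic s).toSet ^ (1 / q) ≤
      ENNReal.ofReal (2 * n ^ (n + 1) * (1 - δ)) * (volume (Q.dyadic s).toSet ^ 2 *
        weightedEnergy (n + δ) q α Q μ (Q.dyadic s).toSet (charEdist E)) := by
  set P := Q.dyadic s with hP
  have hl := P.side_pos
  set l := P.side with hldef
  have hn' : (1 : ℝ) ≤ n := by exact_mod_cast hn
  have hq0 : 0 < q := by linarith
  have hPm := P.measurableSet_toSet
  set f : EuclideanSpace ℝ (Fin n) → ℝ := E.indicator (fun _ => (1 : ℝ)) with hf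
  have hfm : Measurable f := measurable_const.indicator hE
  have hiso := lintegral_edist_le_fractional volume P.convex_toSet hPm hfm (R := n * l)
    (by positivity) (fun x hx y hy => P.dist_le_of_mem_toSet hn hx hy) (by simpa using hn) hδ0 hδ1
  rw [finrank_euclideanSpace_fin] at hiso
  set I := ∫⁻ x in P.toSet, ∫⁻ y in P.toSet, edist (f x) (f y) * invDistKernel (n + δ) x y with hI
  have hab : volume (E ∩ P.toSet) * volume (P.toSet \ E) ≤
      ∫⁻ x in P.toSet, ∫⁻ y in P.toSet, edist (f x) (f y) := by
    calc volume (E ∩ P.toSet) * volume (P.toSet \ E)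
        = ∫⁻ _x in E ∩ P.toSet, ∫⁻ _y in P.toSet \ E, 1 := by simp [mul_comm]
      _ ≤ ∫⁻ x in E ∩ P.toSet, ∫⁻ y in P.toSet \ E, edist (f x) (f y) := by
          refine setLIntegral_mono' (hE.inter hPm) fun x hx =>
            setLIntegral_mono' (hPm.diff hE) fun y hy => ?_
          simp [hf, hx.1, hy.2, edist_dist]
      _ ≤ ∫⁻ x in P.toSet, ∫⁻ y in P.toSet, edist (f x) (f y) :=
          (lintegral_mono fun x => lintegral_mono_set Set.sdiff_subset).trans
            (lintegral_mono_set Set.inter_subset_right)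
  set w := (ENNReal.ofReal (l ^ α) * (μ P.toSet / volume P.toSet)) ^ (1 / q) with hw
  -- The value of `α` is what makes the powers of `l` cancel: `n - δ + (α - n) / q = 0`.
  have hμw : μ P.toSet ^ (1 / q) = ENNReal.ofReal (l ^ ((n : ℝ) - δ)) * w := by
    rw [hw, ENNReal.div_eq_inv_mul, ← mul_assoc, P.volume_toSet,
      ← ENNReal.ofReal_inv_of_pos (by positivity), ← ENNReal.ofReal_mul (by positivity),
      ENNReal.mul_rpow_of_nonneg _ _ (by positivity), ← mul_assoc,
      ENNReal.ofReal_rpow_of_nonneg (by positivity) (by positivity),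
      ← ENNReal.ofReal_mul (by positivity)]
    have : l ^ ((n : ℝ) - δ) * (l ^ α * (l ^ n)⁻¹) ^ (1 / q) = 1 := by
      rw [← Real.rpow_natCast, ← Real.rpow_neg hl.le, ← Real.rpow_add hl, ← Real.rpow_mul hl.le,
        ← Real.rpow_add hl, hα]
      have : (n : ℝ) - δ + (n - q * (n - δ) + -n) * (1 / q) = 0 := by field_simp; ring
      rw [this, Real.rpow_zero]
    rw [hldef] at this ⊢
    rw [this]; simp
  -- On `P` the constant `w` is below the maximal function to the power `1/q`. The inner integral
  -- may grow from `P` to `Q`, since only the outer variable must stay localized for the sum over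
  -- cubes.
  have hIw : I * w ≤ weightedEnergy (n + δ) q α Q μ P.toSet (charEdist E) := by
    rw [mul_comm]
    refine (lintegral_const_mul_le _ _).trans (setLIntegral_mono' hPm fun x hx => ?_)
    rw [mul_comm]
    refine mul_le_mul' (lintegral_mono_set (Q.dyadicSubcube_subset s.1 s.2)) ?_
    exact ENNReal.rpow_le_rpow (le_dyadicFracMaximal α Q μ s hx) (by positivity)
  -- The powers of `l` combine to `|P|²`, and `n ^ (n + δ) ≤ n ^ (n + 1)` makes the constant uniform
  -- in `δ`.
  have hconst : (1 - δ) * (2 * (n * l) ^ ((n : ℝ) + δ)) * l ^ ((n : ℝ) - δ) ≤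
      2 * n ^ (n + 1) * (1 - δ) * (l ^ n) ^ 2 := by
    have e1 : l ^ ((n : ℝ) + δ) * l ^ ((n : ℝ) - δ) = (l ^ n) ^ 2 := by
      rw [← Real.rpow_add hl, ← pow_mul, ← Real.rpow_natCast]
      congr 1; push_cast; ring
    have e2 : (n : ℝ) ^ ((n : ℝ) + δ) ≤ n ^ (n + 1) := by
      rw [← Real.rpow_natCast]
      exact Real.rpow_le_rpow_of_exponent_le hn' (by push_cast; linarith)
    rw [Real.mul_rpow (by positivity) hl.le]
    calc (1 - δ) * (2 * ((n : ℝ) ^ ((n : ℝ) + δ) * l ^ ((n : ℝ) + δ))) * l ^ ((n : ℝ) - δ)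
        = (2 * (n : ℝ) ^ ((n : ℝ) + δ) * (1 - δ)) *
          (l ^ ((n : ℝ) + δ) * l ^ ((n : ℝ) - δ)) := by ring
      _ ≤ _ := by
          rw [e1]
          have : 0 ≤ 1 - δ := by linarith
          gcongr
  calc volume (E ∩ P.toSet) * volume (P.toSet \ E) * μ P.toSet ^ (1 / q)
      ≤ (ENNReal.ofReal ((1 - δ) * (2 * (n * l) ^ ((n : ℝ) + δ))) * I) *
        (ENNReal.ofReal (l ^ ((n : ℝ) - δ)) * w) := by
        rw [hμw]; exact mul_le_mul_left (hab.trans hiso) _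
    _ = ENNReal.ofReal ((1 - δ) * (2 * (n * l) ^ ((n : ℝ) + δ)) * l ^ ((n : ℝ) - δ)) * (I * w) := by
        have : 0 ≤ 1 - δ := by linarith
        rw [ENNReal.ofReal_mul (p := (1 - δ) * (2 * (n * l) ^ ((n : ℝ) + δ))) (by positivity)]
        ring
    _ ≤ ENNReal.ofReal (2 * n ^ (n + 1) * (1 - δ) * (l ^ n) ^ 2) *
        weightedEnergy (n + δ) q α Q μ P.toSet (charEdist E) := by gcongr
    _ = _ := by
        have : 0 ≤ 1 - δ := by linarith
        rw [P.volume_toSet, ENNReal.ofReal_mul (by positivity),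
          ENNReal.ofReal_pow (p := P.side ^ n) (by positivity), mul_assoc]

/-- `μ`-almost every point of `E ∩ Q` lies in a dyadic cube more than half filled by `E`. -/
def IsDyadicallyDense (Q : Cube n) (μ : Measure (EuclideanSpace ℝ (Fin n)))
    (E : Set (EuclideanSpace ℝ (Fin n))) : Prop :=
  ∀ᵐ x ∂μ, x ∈ E → x ∈ Q.toSet → ∃ s : Cube.DyadicIndex n, x ∈ (Q.dyadic s).toSet ∧
    volume (Q.dyadic s).toSet < 2 * volume (E ∩ (Q.dyadic s).toSet)

/-- Density and balancing cover `μ`-almost all of `E ∩ Q` by maximal balanced cubes. In each, `E`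
and its complement have volume comparable to `|P|`, so `|P|²` cancels from the isoperimetric
inequality, at a cost of `2 ^ (n + 1) * 2`. For `μ` only countable subadditivity is used. -/
theorem measure_inter_rpow_le (hn : 1 ≤ n) {δ q α : ℝ} (hδ0 : 0 ≤ δ) (hδ1 : δ < 1)
    (hq : 1 ≤ q) (hα : α = n - q * (n - δ)) (Q : Cube n)
    (μ : Measure (EuclideanSpace ℝ (Fin n)))
    {E : Set (EuclideanSpace ℝ (Fin n))} (hE : MeasurableSet E)
    (hhalf : 2 * volume (E ∩ Q.toSet) ≤ volume Q.toSet) (hdense : IsDyadicallyDense Q μ E) :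
    μ (E ∩ Q.toSet) ^ (1 / q) ≤ 2 ^ (n + 2) * (ENNReal.ofReal (2 * n ^ (n + 1) * (1 - δ)) *
        weightedEnergy (n + δ) q α Q μ Q.toSet (charEdist E)) := by
  have hq0 : 0 < q := by linarith
  set c := ENNReal.ofReal (2 * n ^ (n + 1) * (1 - δ)) with hc
  set W := fun S => weightedEnergy (n + δ) q α Q μ S (charEdist E) with hW
  set G : Cube.DyadicIndex n → Prop := fun s => Cube.IsBalanced E (Q.dyadic s) with hG
  have hbal : ∀ s, G s → μ (Q.dyadic s).toSet ^ (1 / q) ≤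
      2 ^ (n + 2) * (c * W (Q.dyadic s).toSet) := by
    intro s hs
    set P := Q.dyadic s with hP
    have hV0 := P.volume_toSet_ne_zero
    have hVt := P.volume_toSet_ne_top
    have hsplit : volume (E ∩ P.toSet) + volume (P.toSet \ E) = volume P.toSet := by
      rw [Set.inter_comm]; exact measure_inter_add_sdiff _ hE
    have hat : volume (E ∩ P.toSet) ≠ ⊤ :=
      ne_top_of_le_ne_top hVt (measure_mono Set.inter_subset_right)
    have hb : volume P.toSet ≤ 2 * volume (P.toSet \ E) := by
      have h2 := hs.2
      rw [← hsplit, two_mul] at h2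
      have := (ENNReal.add_le_add_iff_left hat).1 h2
      rw [← hsplit, two_mul]
      gcongr
    have h := volume_mul_volume_mul_measure_le hn hδ0 hδ1 hq hα Q μ hE s
    have h2 : volume P.toSet ^ 2 * μ P.toSet ^ (1 / q) ≤
        volume P.toSet ^ 2 * (2 ^ (n + 2) * (c * W P.toSet)) := by
      calc volume P.toSet ^ 2 * μ P.toSet ^ (1 / q) =
          volume P.toSet * volume P.toSet * μ P.toSet ^ (1 / q) := by rw [sq]
        _ ≤ (2 ^ (n + 1) * volume (E ∩ P.toSet)) * (2 * volume (P.toSet \ E)) *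
            μ P.toSet ^ (1 / q) := by gcongr; exact hs.1
        _ = 2 ^ (n + 2) * (volume (E ∩ P.toSet) * volume (P.toSet \ E) *
            μ P.toSet ^ (1 / q)) := by ring
        _ ≤ 2 ^ (n + 2) * (c * (volume P.toSet ^ 2 * W P.toSet)) := by gcongr
        _ = _ := by ring
    exact (ENNReal.mul_le_mul_iff_right (pow_ne_zero 2 hV0) (ENNReal.pow_ne_top hVt)).1 h2
  set M := {s : Cube.DyadicIndex n // Q.IsMaximalDyadic G s} with hM
  have hcover : μ (E ∩ Q.toSet) ≤ μ (⋃ s : M, (Q.dyadic s.1).toSet) := by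
    refine measure_mono_ae ?_
    filter_upwards [hdense] with x hx hxE
    obtain ⟨s, hxs, hs⟩ := hx hxE.1 hxE.2
    obtain ⟨t, ht, hst⟩ := Q.exists_isBalanced hhalf s hs
    obtain ⟨t', ht', htt'⟩ := Q.exists_isMaximalDyadic G ht
    exact Set.mem_iUnion.2 ⟨⟨t', ht'⟩, htt' (hst hxs)⟩
  have hsumW : ∑' s : M, W (Q.dyadic s.1).toSet ≤ W Q.toSet := by
    simp only [hW, weightedEnergy]
    rw [← lintegral_iUnion₀ (fun s : M => (Q.dyadic s.1).measurableSet_toSet.nullMeasurableSet)]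
    · exact lintegral_mono_set (Set.iUnion_subset fun s => Q.dyadicSubcube_subset _ _)
    · intro s t hst
      exact s.2.aedisjoint Q t.2 fun h => hst (Subtype.ext h)
  calc μ (E ∩ Q.toSet) ^ (1 / q) ≤ (∑' s : M, μ (Q.dyadic s.1).toSet) ^ (1 / q) :=
        ENNReal.rpow_le_rpow (hcover.trans (measure_iUnion_le _)) (by positivity)
    _ ≤ ∑' s : M, μ (Q.dyadic s.1).toSet ^ (1 / q) :=
        ENNReal.tsum_rpow_le_rpow _ (by positivity) ((div_le_one hq0).2 hq)
    _ ≤ ∑' s : M, 2 ^ (n + 2) * (c * W (Q.dyadic s.1).toSet) :=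
        ENNReal.tsum_le_tsum fun s => hbal s.1 s.2.1
    _ = 2 ^ (n + 2) * (c * ∑' s : M, W (Q.dyadic s.1).toSet) := by
        rw [ENNReal.tsum_mul_left, ENNReal.tsum_mul_left]
    _ ≤ _ := by gcongr

/-- The average of `|1_E(x) - 1_E(y)|` over `y ∈ Q`. -/
noncomputable def avgCharEdist (Q : Cube n) (E : Set (EuclideanSpace ℝ (Fin n)))
    (x : EuclideanSpace ℝ (Fin n)) : ℝ≥0∞ :=
  (volume Q.toSet)⁻¹ * ∫⁻ y in Q.toSet, charEdist E x y

theorem avgCharEdist_le (Q : Cube n) {E : Set (EuclideanSpace ℝ (Fin n))} (hE : MeasurableSet E)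
    (x : EuclideanSpace ℝ (Fin n)) : avgCharEdist Q E x ≤
      E.indicator 1 x + (volume Q.toSet)⁻¹ * volume (E ∩ Q.toSet) := by
  have h : ∫⁻ y in Q.toSet, charEdist E x y ≤
      E.indicator 1 x * volume Q.toSet + volume (E ∩ Q.toSet) := by
    refine (lintegral_mono fun y => charEdist_le E x y).trans_eq ?_
    rw [lintegral_add_left measurable_const, lintegral_const, lintegral_indicator_one hE]
    simp [Measure.restrict_apply hE]
  refine (mul_le_mul_right h _).trans_eq ?_
  rw [mul_add, mul_left_comm, ENNReal.inv_mul_cancel Q.volume_toSet_ne_zero Q.volume_toSet_ne_top,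
    mul_one]

/-- The average is at most `1_E(x) + |E ∩ Q| / |Q|`. The first term is `measure_inter_rpow_le`; the
second is the isoperimetric inequality on `Q` itself, whose part outside `E` is at least half of
`Q`. -/
theorem lintegral_avgCharEdist_le_of_half (hn : 1 ≤ n) {δ q α : ℝ} (hδ0 : 0 ≤ δ) (hδ1 : δ < 1)
    (hq : 1 ≤ q) (hα : α = n - q * (n - δ)) (Q : Cube n)
    (μ : Measure (EuclideanSpace ℝ (Fin n)))
    {E : Set (EuclideanSpace ℝ (Fin n))} (hE : MeasurableSet E)
    (hhalf : 2 * volume (E ∩ Q.toSet) ≤ volume Q.toSet) (hdense : IsDyadicallyDense Q μ E) :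
    (∫⁻ x in Q.toSet, avgCharEdist Q E x ^ q ∂μ) ^ (1 / q) ≤
      2 ^ (n + 3) * (ENNReal.ofReal (2 * n ^ (n + 1) * (1 - δ)) *
        weightedEnergy (n + δ) q α Q μ Q.toSet (charEdist E)) := by
  have hq0 : 0 < q := by linarith
  set c := ENNReal.ofReal (2 * n ^ (n + 1) * (1 - δ)) with hc
  set W := weightedEnergy (n + δ) q α Q μ Q.toSet (charEdist E) with hW
  set V := volume Q.toSet with hV
  have hV0 : V ≠ 0 := Q.volume_toSet_ne_zero
  have hVt : V ≠ ⊤ := Q.volume_toSet_ne_top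
  set a := volume (E ∩ Q.toSet) with ha
  have hmain := measure_inter_rpow_le hn hδ0 hδ1 hq hα Q μ hE hhalf hdense
  have hmean : (V⁻¹ * a) * μ Q.toSet ^ (1 / q) ≤ 2 * (c * W) := by
    have h := volume_mul_volume_mul_measure_le hn hδ0 hδ1 hq hα Q μ hE
      ⟨0, fun _ => ⟨0, by simp⟩⟩
    simp only [Cube.dyadic, Cube.dyadicSubcube_zero_toSet] at h
    have hsplit : a + volume (Q.toSet \ E) = V := by
      rw [ha, Set.inter_comm]; exact measure_inter_add_sdiff _ hE
    have hat : a ≠ ⊤ := ne_top_of_le_ne_top hVt (measure_mono Set.inter_subset_right)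
    have hb : V ≤ 2 * volume (Q.toSet \ E) := by
      rw [← hsplit, two_mul] at hhalf
      have := (ENNReal.add_le_add_iff_left hat).1 hhalf
      rw [← hsplit, two_mul]
      gcongr
    have h2 : V ^ 2 * ((V⁻¹ * a) * μ Q.toSet ^ (1 / q)) ≤ V ^ 2 * (2 * (c * W)) := by
      calc V ^ 2 * ((V⁻¹ * a) * μ Q.toSet ^ (1 / q)) =
          (V * V⁻¹) * (a * V * μ Q.toSet ^ (1 / q)) := by ring
        _ = a * V * μ Q.toSet ^ (1 / q) := by rw [ENNReal.mul_inv_cancel hV0 hVt, one_mul]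
        _ ≤ a * (2 * volume (Q.toSet \ E)) * μ Q.toSet ^ (1 / q) := by gcongr
        _ = 2 * (a * volume (Q.toSet \ E) * μ Q.toSet ^ (1 / q)) := by ring
        _ ≤ 2 * (c * (V ^ 2 * W)) := by gcongr
        _ = _ := by ring
    exact (ENNReal.mul_le_mul_iff_right (pow_ne_zero 2 hV0) (ENNReal.pow_ne_top hVt)).1 h2
  have hind : Measurable (E.indicator (1 : EuclideanSpace ℝ (Fin n) → ℝ≥0∞)) :=
    measurable_one.indicator hE
  calc (∫⁻ x in Q.toSet, avgCharEdist Q E x ^ q ∂μ) ^ (1 / q)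
      ≤ (∫⁻ x in Q.toSet, (E.indicator (1 : EuclideanSpace ℝ (Fin n) → ℝ≥0∞) +
          (fun _ => V⁻¹ * a : EuclideanSpace ℝ (Fin n) → ℝ≥0∞)) x ^ q ∂μ) ^ (1 / q) := by
        gcongr with x
        exact avgCharEdist_le Q hE x
    _ ≤ (∫⁻ x in Q.toSet, E.indicator 1 x ^ q ∂μ) ^ (1 / q) +
        (∫⁻ _x in Q.toSet, (V⁻¹ * a) ^ q ∂μ) ^ (1 / q) :=
        ENNReal.lintegral_Lp_add_le hind.aemeasurable aemeasurable_const hq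
    _ = μ (E ∩ Q.toSet) ^ (1 / q) + (V⁻¹ * a) * μ Q.toSet ^ (1 / q) := by
        congr 1
        · have : ∀ x, E.indicator (1 : EuclideanSpace ℝ (Fin n) → ℝ≥0∞) x ^ q =
              E.indicator 1 x := fun x => by
            by_cases hx : x ∈ E <;> simp [hx, hq0]
          simp_rw [this]
          rw [lintegral_indicator_one hE, Measure.restrict_apply hE]
        · rw [setLIntegral_const, ENNReal.mul_rpow_of_nonneg _ _ (by positivity),
            ← ENNReal.rpow_mul, mul_one_div_cancel hq0.ne', ENNReal.rpow_one]
    _ ≤ 2 ^ (n + 2) * (c * W) + 2 * (c * W) := add_le_add hmain hmean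
    _ ≤ 2 ^ (n + 2) * (c * W) + 2 ^ (n + 2) * (c * W) := by
        gcongr
        exact le_self_pow₀ (by norm_num) (by omega)
    _ = _ := by ring

/-- Both sides are unchanged when `E` is replaced by its complement, so the smaller of the two in
`Q` may be used. This is why density is required of both. -/
theorem lintegral_avgCharEdist_le (hn : 1 ≤ n) {δ q α : ℝ} (hδ0 : 0 ≤ δ) (hδ1 : δ < 1)
    (hq : 1 ≤ q) (hα : α = n - q * (n - δ)) (Q : Cube n)
    (μ : Measure (EuclideanSpace ℝ (Fin n)))
    {E : Set (EuclideanSpace ℝ (Fin n))} (hE : MeasurableSet E)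
    (hdense : IsDyadicallyDense Q μ E) (hdense' : IsDyadicallyDense Q μ Eᶜ) :
    (∫⁻ x in Q.toSet, avgCharEdist Q E x ^ q ∂μ) ^ (1 / q) ≤
      2 ^ (n + 3) * (ENNReal.ofReal (2 * n ^ (n + 1) * (1 - δ)) *
        weightedEnergy (n + δ) q α Q μ Q.toSet (charEdist E)) := by
  have hcompl : charEdist Eᶜ = charEdist E := by
    ext x y; exact charEdist_compl E x y
  rcases le_total (volume (E ∩ Q.toSet)) (volume (Eᶜ ∩ Q.toSet)) with h | h
  · refine lintegral_avgCharEdist_le_of_half hn hδ0 hδ1 hq hα Q μ hE ?_ hdense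
    rw [two_mul, ← measure_inter_add_sdiff Q.toSet hE, Set.inter_comm Q.toSet, Set.sdiff_eq,
      Set.inter_comm Q.toSet]
    gcongr
  · have := lintegral_avgCharEdist_le_of_half hn hδ0 hδ1 hq hα Q μ hE.compl ?_ hdense'
    · simpa only [avgCharEdist, hcompl] using this
    rw [two_mul, ← measure_inter_add_sdiff Q.toSet hE, Set.inter_comm Q.toSet, Set.sdiff_eq,
      Set.inter_comm Q.toSet]
    gcongr

end Poincare

/-! ### Dyadic density and passage from sets to functions -/

section Main

variable {n : ℕ}

/-- Around a point of `O`, a sufficiently fine dyadic cube is contained in `O` and so is completely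
filled by `E`. No relation between `μ` and Lebesgue measure is needed. -/
theorem isDyadicallyDense_of_isOpen_subset (hn : 1 ≤ n) (Q : Cube n)
    (μ : Measure (EuclideanSpace ℝ (Fin n))) {O E : Set (EuclideanSpace ℝ (Fin n))}
    (hO : IsOpen O) (hOE : O ⊆ E) (hμ : ∀ᵐ x ∂μ, x ∈ E → x ∈ O) : IsDyadicallyDense Q μ E := by
  filter_upwards [hμ] with x hx hxE hxQ
  obtain ⟨ε, hε, hball⟩ := Metric.isOpen_iff.1 hO x (hx hxE)
  have hlim : Filter.Tendsto (fun k : ℕ => (n : ℝ) * (Q.side / 2 ^ k)) Filter.atTop (nhds 0) := by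
    have := (tendsto_pow_atTop_nhds_zero_of_lt_one (r := (2⁻¹ : ℝ)) (by norm_num)
      (by norm_num)).const_mul ((n : ℝ) * Q.side)
    simpa [div_eq_mul_inv, mul_assoc] using this
  obtain ⟨k, hk⟩ := (hlim.eventually_lt_const hε).exists
  obtain ⟨m, hm⟩ := Q.exists_mem_dyadicSubcube k hxQ
  refine ⟨⟨k, m⟩, hm, ?_⟩
  have hsub : (Q.dyadic ⟨k, m⟩).toSet ⊆ E := fun y hy =>
    hOE (hball (((Q.dyadicSubcube k m).dist_le_of_mem_toSet hn hy hm).trans_lt hk))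
  rw [Set.inter_eq_self_of_subset_right hsub, two_mul]
  exact ENNReal.lt_add_right (Cube.volume_toSet_ne_top _) (Cube.volume_toSet_ne_zero _)

/-- Lebesgue density along dyadic cubes. -/
theorem isDyadicallyDense_of_absolutelyContinuous (Q : Cube n)
    {μ : Measure (EuclideanSpace ℝ (Fin n))} (hμ : μ ≪ volume)
    {E : Set (EuclideanSpace ℝ (Fin n))} (hE : MeasurableSet E) : IsDyadicallyDense Q μ E := by
  -- In the sup norm of `Fin n → ℝ` cubes are closed balls, so the density theorem for doubling
  -- measures applies. Its parameter `1` admits balls that contain the point without being centred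
  -- there.
  set S : Set (Fin n → ℝ) := WithLp.toLp 2 ⁻¹' E with hS
  have hSm : MeasurableSet S := (PiLp.volume_preserving_toLp (Fin n)).measurable hE
  have hae := IsUnifLocDoublingMeasure.ae_tendsto_measure_inter_div
    (volume : Measure (Fin n → ℝ)) S 1
  rw [ae_restrict_iff' hSm] at hae
  have hae2 := hμ.ae_le
    ((PiLp.volume_preserving_ofLp (Fin n)).quasiMeasurePreserving.ae hae)
  filter_upwards [hae2] with x hx hxE hxQ
  choose m hm using fun k => Q.exists_mem_dyadicSubcube k hxQ
  set P : ℕ → Cube n := fun k => Q.dyadicSubcube k (m k) with hP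
  set w : ℕ → Fin n → ℝ := fun k i => (P k).corner i + (P k).side / 2 with hw
  have hball : ∀ k, Metric.closedBall (w k) ((P k).side / 2) =
      Set.Icc (fun i => (P k).corner i) (fun i => (P k).corner i + (P k).side) := by
    intro k
    rw [closedBall_pi _ (half_pos (P k).side_pos).le, ← Set.pi_univ_Icc]
    refine Set.pi_congr rfl fun i _ => ?_
    rw [Real.closedBall_eq_Icc]
    congr 1 <;> simp only [hw] <;> ring
  have hlim : Filter.Tendsto (fun k : ℕ => (P k).side / 2) Filter.atTop
      (nhdsWithin 0 (Set.Ioi 0)) := by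
    refine tendsto_nhdsWithin_iff.2 ⟨?_, Filter.Eventually.of_forall fun k =>
      half_pos (P k).side_pos⟩
    have := (tendsto_pow_atTop_nhds_zero_of_lt_one (r := (2⁻¹ : ℝ)) (by norm_num)
      (by norm_num)).const_mul (Q.side / 2)
    simp only [mul_zero] at this
    refine this.congr fun k => ?_
    simp only [hP, Cube.dyadicSubcube_side, inv_pow]
    ring
  have ht := hx hxE w (fun k => (P k).side / 2) hlim (Filter.Eventually.of_forall fun k => by
    rw [one_mul, hball]
    have := hm k
    rwa [Cube.toSet_eq_preimage] at this)
  have hhalf : (2⁻¹ : ℝ≥0∞) < 1 := by simp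
  obtain ⟨k, hk⟩ := (ht.eventually_const_lt hhalf).exists
  refine ⟨⟨k, m k⟩, hm k, ?_⟩
  have hmp := PiLp.volume_preserving_ofLp (Fin n)
  have e1 : volume (P k).toSet = volume (Metric.closedBall (w k) ((P k).side / 2)) := by
    rw [hball, Cube.toSet_eq_preimage, hmp.measure_preimage measurableSet_Icc.nullMeasurableSet]
  have e2 : volume (E ∩ (P k).toSet) =
      volume (S ∩ Metric.closedBall (w k) ((P k).side / 2)) := by
    rw [hball, Cube.toSet_eq_preimage, ← hmp.measure_preimage
      (hSm.inter measurableSet_Icc).nullMeasurableSet]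
    rfl
  rw [← e1, ← e2, ENNReal.lt_div_iff_mul_lt (Or.inl (Cube.volume_toSet_ne_zero _))
    (Or.inl (Cube.volume_toSet_ne_top _))] at hk
  change volume (P k).toSet < 2 * volume (E ∩ (P k).toSet)
  have h2 := (ENNReal.mul_lt_mul_iff_right (a := 2) (by simp) (by simp)).2 hk
  rwa [← mul_assoc, ENNReal.mul_inv_cancel (by simp) (by simp), one_mul] at h2

theorem edist_setAverage_le (Q : Cube n) {f : EuclideanSpace ℝ (Fin n) → ℝ}
    (hf : IntegrableOn f Q.toSet) (x : EuclideanSpace ℝ (Fin n)) :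
    edist (f x) (⨍ z in Q.toSet, f z ∂volume) ≤
      (volume Q.toSet)⁻¹ * ∫⁻ y in Q.toSet, edist (f x) (f y) := by
  have hV0 := Q.volume_toSet_ne_zero
  have hVt := Q.volume_toSet_ne_top
  have hr : 0 < volume.real Q.toSet := ENNReal.toReal_pos hV0 hVt
  have hc : IntegrableOn (fun _ => f x) Q.toSet := integrableOn_const hVt
  have h : f x - ⨍ z in Q.toSet, f z ∂volume =
      (volume.real Q.toSet)⁻¹ * ∫ y in Q.toSet, (f x - f y) := by
    rw [integral_sub hc hf, setAverage_eq, setIntegral_const, smul_eq_mul, smul_eq_mul]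
    field_simp
  rw [edist_eq_enorm_sub, h, enorm_mul]
  refine mul_le_mul' ?_ ?_
  · rw [Real.enorm_eq_ofReal (by positivity), ENNReal.ofReal_inv_of_pos hr, measureReal_def,
      ENNReal.ofReal_toReal hVt]
  · simp_rw [edist_eq_enorm_sub]
    exact enorm_integral_le_lintegral_enorm _

theorem measurable_charEdist_superlevel {X : Type*} [MeasurableSpace X] {f : X → ℝ}
    (hf : Measurable f) :
    Measurable fun z : (X × ℝ) × X => charEdist {w | z.1.2 < f w} z.1.1 z.2 := by
  have h : Measurable ({w : X × ℝ | w.2 < f w.1}.indicator fun _ => (1 : ℝ)) :=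
    measurable_const.indicator (measurableSet_lt measurable_snd (hf.comp measurable_fst))
  exact (h.comp measurable_fst).edist
    (h.comp (measurable_snd.prodMk (measurable_snd.comp measurable_fst)))

/-- Together with `edist_setAverage_le`, this dominates `|f - f_Q|` by an integral over levels, the
form to which Minkowski's inequality applies. -/
theorem lintegral_avgCharEdist_superlevel (Q : Cube n) {f : EuclideanSpace ℝ (Fin n) → ℝ}
    (hf : Measurable f) (x : EuclideanSpace ℝ (Fin n)) :
    ∫⁻ t : ℝ, avgCharEdist Q {z | t < f z} x =
      (volume Q.toSet)⁻¹ * ∫⁻ y in Q.toSet, edist (f x) (f y) := by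
  unfold avgCharEdist
  rw [lintegral_const_mul' _ _ (ENNReal.inv_ne_top.2 Q.volume_toSet_ne_zero),
    lintegral_lintegral_swap]
  · simp_rw [lintegral_charEdist_superlevel]
  · exact ((measurable_charEdist_superlevel hf).comp
      ((measurable_const.prodMk measurable_fst).prodMk measurable_snd)).aemeasurable

/-- Coarea formula for weighted double integrals of `|f(x) - f(y)|`. -/
theorem lintegral_superlevel_charEdist_mul {X : Type*} [MeasurableSpace X] (ν : Measure X)
    [SFinite ν] {f : X → ℝ} (hf : Measurable f) {K : X → X → ℝ≥0∞}
    (hK : Measurable (Function.uncurry K)) {M : X → ℝ≥0∞} (hM : Measurable M) :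
    ∫⁻ t : ℝ, ∫⁻ x, (∫⁻ y, charEdist {w | t < f w} x y * K x y ∂ν) * M x ∂ν =
      ∫⁻ x, (∫⁻ y, edist (f x) (f y) * K x y ∂ν) * M x ∂ν := by
  have hc := measurable_charEdist_superlevel hf
  have hk : Measurable fun z : (X × ℝ) × X =>
      charEdist {w | z.1.2 < f w} z.1.1 z.2 * K z.1.1 z.2 :=
    hc.mul (hK.comp ((measurable_fst.comp measurable_fst).prodMk measurable_snd))
  have hin : Measurable fun z : X × ℝ =>
      ∫⁻ y, charEdist {w | z.2 < f w} z.1 y * K z.1 y ∂ν := hk.lintegral_prod_right'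
  rw [lintegral_lintegral_swap]
  · refine lintegral_congr fun x => ?_
    have hm : Measurable fun t : ℝ => (x, t) := by fun_prop
    have hx : Measurable fun t : ℝ => ∫⁻ y, charEdist {w | t < f w} x y * K x y ∂ν := by
      have h := hin.comp hm
      simp only [Function.comp_def] at h
      exact h
    rw [lintegral_mul_const _ hx, lintegral_lintegral_swap]
    · congr 1
      refine lintegral_congr fun y => ?_
      have hm : Measurable fun t : ℝ => ((x, t), y) := by fun_prop
      have hy : Measurable fun t : ℝ => charEdist {w | t < f w} x y := hc.comp hm
      rw [lintegral_mul_const _ hy, lintegral_charEdist_superlevel]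
    · have hm : Measurable fun z : ℝ × X => ((x, z.1), z.2) := by fun_prop
      exact (hk.comp hm).aemeasurable
  · exact ((hin.comp (measurable_snd.prodMk measurable_fst)).mul
      (hM.comp measurable_snd)).aemeasurable

theorem lintegral_weightedEnergy_superlevel (p q α : ℝ) (Q : Cube n)
    (μ : Measure (EuclideanSpace ℝ (Fin n))) {f : EuclideanSpace ℝ (Fin n) → ℝ}
    (hf : Measurable f) :
    ∫⁻ t : ℝ, weightedEnergy p q α Q μ Q.toSet (charEdist {z | t < f z}) =
      weightedEnergy p q α Q μ Q.toSet (fun x y => edist (f x) (f y)) :=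
  lintegral_superlevel_charEdist_mul _ hf (measurable_invDistKernel p)
    ((measurable_dyadicFracMaximal α Q μ).pow_const (1 / q))

/-- The weighted inequality for a measurable function whose superlevel sets and their complements
are dyadically dense. -/
theorem lintegral_edist_setAverage_le (hn : 1 ≤ n) {δ q α : ℝ} (hδ0 : 0 ≤ δ) (hδ1 : δ < 1)
    (hq : 1 ≤ q) (hα : α = n - q * (n - δ)) (Q : Cube n)
    (μ : Measure (EuclideanSpace ℝ (Fin n))) [IsFiniteMeasureOnCompacts μ]
    {f : EuclideanSpace ℝ (Fin n) → ℝ} (hf : Measurable f) (hfi : IntegrableOn f Q.toSet)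
    (hdense : ∀ᵐ t : ℝ, IsDyadicallyDense Q μ {x | t < f x} ∧
      IsDyadicallyDense Q μ {x | t < f x}ᶜ) :
    (∫⁻ x in Q.toSet, edist (f x) (⨍ z in Q.toSet, f z ∂volume) ^ q ∂μ) ^ (1 / q) ≤
      ENNReal.ofReal (2 ^ (n + 3) * (2 * n ^ (n + 1)) * (1 - δ)) *
        weightedEnergy (n + δ) q α Q μ Q.toSet (fun x y => edist (f x) (f y)) := by
  have hq0 : 0 < q := by linarith
  have : IsFiniteMeasure (μ.restrict Q.toSet) :=
    ⟨by rw [Measure.restrict_apply_univ]; exact Q.isCompact_toSet.measure_lt_top⟩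
  have hF : Measurable (Function.uncurry fun x t => avgCharEdist Q {z | t < f z} x) := by
    refine Measurable.const_mul ?_ _
    exact (measurable_charEdist_superlevel hf).lintegral_prod_right'
  calc (∫⁻ x in Q.toSet, edist (f x) (⨍ z in Q.toSet, f z ∂volume) ^ q ∂μ) ^ (1 / q)
      ≤ (∫⁻ x in Q.toSet, (∫⁻ t : ℝ, avgCharEdist Q {z | t < f z} x) ^ q ∂μ) ^ (1 / q) := by
        gcongr with x
        rw [lintegral_avgCharEdist_superlevel Q hf]
        exact edist_setAverage_le Q hfi x
    _ ≤ ∫⁻ t : ℝ, (∫⁻ x in Q.toSet, avgCharEdist Q {z | t < f z} x ^ q ∂μ) ^ (1 / q) :=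
        lintegral_rpow_lintegral_le _ _ hq hF
    _ ≤ ∫⁻ t : ℝ, ENNReal.ofReal (2 ^ (n + 3) * (2 * n ^ (n + 1)) * (1 - δ)) *
          weightedEnergy (n + δ) q α Q μ Q.toSet (charEdist {z | t < f z}) := by
        refine lintegral_mono_ae (hdense.mono fun t ht => ?_)
        refine (lintegral_avgCharEdist_le hn hδ0 hδ1 hq hα Q μ
          (measurableSet_lt measurable_const hf) ht.1 ht.2).trans_eq ?_
        rw [mul_assoc ((2 : ℝ) ^ (n + 3)), ENNReal.ofReal_mul (p := (2 : ℝ) ^ (n + 3))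
          (by positivity), ENNReal.ofReal_pow (by norm_num), mul_assoc]
        simp [mul_assoc]
    _ = _ := by
        rw [lintegral_const_mul' _ _ ENNReal.ofReal_ne_top,
          lintegral_weightedEnergy_superlevel _ _ _ _ _ hf]

/-- The set `{f > t}` is open. Its complement differs from the open set `{f < t}` by the level set
`{f = t}`, which is `μ`-null for all but countably many `t`. -/
theorem isDyadicallyDense_superlevel_of_continuous (hn : 1 ≤ n) (Q : Cube n)
    (μ : Measure (EuclideanSpace ℝ (Fin n))) [SFinite μ] {f : EuclideanSpace ℝ (Fin n) → ℝ}
    (hf : Continuous f) :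
    ∀ᵐ t : ℝ, IsDyadicallyDense Q μ {x | t < f x} ∧ IsDyadicallyDense Q μ {x | t < f x}ᶜ := by
  have hc := (Measure.countable_meas_level_set_pos (μ := μ) hf.measurable).ae_notMem volume
  filter_upwards [hc] with t ht
  constructor
  · exact isDyadicallyDense_of_isOpen_subset hn Q μ (isOpen_lt continuous_const hf) subset_rfl
      (Filter.Eventually.of_forall fun _ h => h)
  · refine isDyadicallyDense_of_isOpen_subset hn Q μ (isOpen_lt hf continuous_const)
      (fun x (hx : f x < t) => not_lt.2 hx.le) ?_
    have h0 : μ {x | f x = t} = 0 := by simpa using ht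
    filter_upwards [measure_eq_zero_iff_ae_notMem.1 h0] with x hx hxt
    exact lt_of_le_of_ne (not_lt.1 hxt) hx

end Main

/-- Weighted fractional `(q,1)`-Poincaré inequality. Both sides are Lebesgue integrals of
nonnegative functions with values in `[0, ∞]`; the constant depends only on `n`. -/
theorem mainTheorem1 (n : ℕ) (hn : 1 ≤ n) :
    ∃ C : ℝ, 0 < C ∧
      ∀ δ q α : ℝ, 0 ≤ δ → δ < 1 → 1 ≤ q → q ≤ (n : ℝ) / ((n : ℝ) - δ) →
        α = (n : ℝ) - q * ((n : ℝ) - δ) →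
      ∀ (μ : Measure (EuclideanSpace ℝ (Fin n))) [μ.Regular]
        (f : EuclideanSpace ℝ (Fin n) → ℝ),
        ((LocallyIntegrable f volume ∧ μ ≪ volume) ∨ Continuous f) →
      ∀ Q : Cube n,
        (∫⁻ x in Q.toSet,
            ENNReal.ofReal (|f x - ⨍ z in Q.toSet, f z ∂volume| ^ q) ∂μ) ^ (1 / q) ≤
          ENNReal.ofReal (C * (1 - δ)) *
            ∫⁻ x in Q.toSet,
              (∫⁻ y in Q.toSet,
                ENNReal.ofReal (|f x - f y| / ‖x - y‖ ^ ((n : ℝ) + δ)) ∂volume) *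
              dyadicFracMaximal α Q μ x ^ (1 / q) ∂volume := by
  have hn' : (0 : ℝ) < n := by exact_mod_cast hn
  -- The factor `2 * n ^ (n + 1)` comes from the fractional Poincaré inequality with diameter bound
  -- `n * l`; `2 ^ (n + 3)` comes from balancing and from the two terms of the set estimate.
  refine ⟨2 ^ (n + 3) * (2 * n ^ (n + 1)), by positivity, ?_⟩
  intro δ q α hδ0 hδ1 hq _ hα μ _ f hf Q
  have hq0 : 0 < q := by linarith
  have hl : ∀ a b : ℝ, ENNReal.ofReal (|a - b| ^ q) = edist a b ^ q := fun a b => by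
    rw [← ENNReal.ofReal_rpow_of_nonneg (abs_nonneg _) hq0.le, edist_dist, Real.dist_eq]
  have hr : ∀ x y, ENNReal.ofReal (|f x - f y| / ‖x - y‖ ^ ((n : ℝ) + δ)) =
      edist (f x) (f y) * invDistKernel (n + δ) x y := fun x y => by
    rw [div_eq_mul_inv, ENNReal.ofReal_mul (abs_nonneg _), edist_dist, Real.dist_eq]
    rfl
  simp_rw [hl, hr]
  rcases hf with ⟨hfi, hμ⟩ | hfc
  -- The superlevel sets must be Borel, so `f` is replaced by a Borel representative; absolute
  -- continuity of `μ` keeps the left side unchanged.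
  · obtain ⟨g, hgm, hfg⟩ := hfi.aestronglyMeasurable.aemeasurable
    have hfgQ := ae_restrict_of_ae (s := Q.toSet) hfg
    have hgi : IntegrableOn g Q.toSet :=
      (hfi.integrableOn_isCompact Q.isCompact_toSet).congr hfgQ
    have h := lintegral_edist_setAverage_le hn hδ0 hδ1 hq hα Q μ hgm hgi
      (Filter.Eventually.of_forall fun t =>
        ⟨isDyadicallyDense_of_absolutelyContinuous Q hμ (measurableSet_lt measurable_const hgm),
          isDyadicallyDense_of_absolutelyContinuous Q hμ
            (measurableSet_lt measurable_const hgm).compl⟩)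
    convert h using 2
    · rw [average_congr hfgQ]
      refine lintegral_congr_ae (ae_restrict_of_ae ?_)
      filter_upwards [hμ.ae_le hfg] with x hx
      rw [hx]
    · refine lintegral_congr_ae (hfgQ.mono fun x hx => ?_)
      simp only
      congr 1
      refine lintegral_congr_ae (hfgQ.mono fun y hy => ?_)
      simp only [hx, hy]
  · exact lintegral_edist_setAverage_le hn hδ0 hδ1 hq hα Q μ hfc.measurable
      (hfc.locallyIntegrable.integrableOn_isCompact Q.isCompact_toSet)
      (isDyadicallyDense_superlevel_of_continuous hn Q μ hfc)
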